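/- **Setting.** Consider $x_{k+1}=Ax_k+Bu_k+Dw_k$ with $x_k\in\mathbb R^n$, $u_k\in\mathbb R^{m}$, $w_k\in\mathbb R^{q}$, where $(A,B)$ is stabilizable, $\mathbb W\subset\mathbb R^q$ is bounded and contains the origin in its interior, and $w_0,w_1,\dots$ are i.i.d., almost surely in $\mathbb W$, with $\mathbb E\{w_k\}=0$ and $\mathbb P\{\|w_k\|\le\lambda\}>0$ for all $\lambda>0$. The system is subject to the hard constraint $(x_k,u_k)\in\mathbb Z$, where $\mathbb Z$ is a compact convex polyhedral set containing the origin in its interior, and to the probabilistic constraints $\mathbb P\{f_j^\top x_{k+1}+g_j^\top u_k\le h_j\}\ge p_j$, with $p_j\in(0,1]$, $j=1,\dots,n_c$. Let $\gamma_j$ be such that, for all $(x,u)$, $f_j^\top Ax+(f_j^\top B+g_j^\top)u+\gamma_j\le h_j$ implies $\mathbb P\{f_j^\top(Ax+Bu+Dw_k)+g_j^\top u\le h_j\}\ge p_j$, and let $\mathbb S=\{(x,u): f_j^\top Ax+(f_j^\top B+g_j^\top)u+\gamma_j\le h_j,\ j=1,\dots,n_c\}$. Let $Q,R\succ0$, and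 let $P\succ0$ and $K$ satisfy $$P=Q+A^\top PA-K^\top(R+B^\top PB)K,\qquad K=-(R+B^\top PB)^{-1}B^\top PA .$$ Put $\Phi=A+BK$. *Predictions.* Let $N\ge1$, let $L_1,\dots,L_N\in\mathbb R^{m\times q}$ be arbitrary fixed disturbance feedback gains (in particular $L_1=0$ or $L_N=0$ is allowed), and let ${\bf c}=(c_0,\dots,c_{N-1})$ be the decision variables, with $c_i=0$ for $i\ge N$. The predicted control law is the striped law $$u_{i|k}=Kx_{i|k}+c_{i}+\sum_{j=1}^{\min(i,N)}L_jw_{i-j|k},\qquad i\ge0 .$$ Let $(\bar x_i,\bar u_i)$ be the nominal prediction from $\bar x_0=x$ (all disturbances zero), so that $\bar u_i=K\bar x_i+c_i$ and $\bar x_{i+1}=A\bar x_i+B\bar u_i$, and let $e_i(\mathbf w)$ be the value of $(x_{i|k},u_{i|k})$ obtained from $x_{0|k}=0$, ${\bf c}=0$ and disturbances $\mathbf w$. The tightened sets are $\tilde{\mathbb S}_i=\{z: z+e_i(\mathbf w)\in\mathbb S\ \ \forall\,\mathbf w\in\mathbb W^{\mathbb N}\}$ and $\tilde{\mathbb Z}_i=\{z: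 z+e_i(\mathbf w)\in\mathbb Z\ \ \forall\,\mathbf w\in\mathbb W^{\mathbb N}\}$. *Online problem.* At the state $x$, minimize $$V(x,{\bf c})=x^\top Px+{\bf c}^\top P_c{\bf c},\qquad P_c=I\otimes(R+B^\top PB),$$ over ${\bf c}$ subject to $(\bar x_i,\bar u_i)\in\tilde{\mathbb S}_i\cap\tilde{\mathbb Z}_i$ for $i=0,\dots,N+N_2-1$. Here $N_2$ is so large that, for all $(x,{\bf c})$, these constraints imply $(\bar x_i,\bar u_i)\in\tilde{\mathbb S}_i\cap\tilde{\mathbb Z}_i$ for all $i\ge N$. Let $\mathbb X$ be the set of states $x$ for which the problem is feasible. **Theorem.** For every $x\in\mathbb X$ the online problem has a unique solution ${\bf c}^*(x)$. The function $V^*(x)=V(x,{\bf c}^*(x))$ is an ISS-Lyapunov function on $\mathbb X$ for the closed-loop system $$x_{k+1}=f(x_k,w_k),\qquad f(x,w)=\Phi x+Bc_0^*(x)+Dw,$$ that is: $f(x,w)\in\mathbb X$ for all $(x,w)\in\mathbb X\times\mathbb W$, $V^*$ is continuous on $\mathbb X$, and there are $\mathcal K_\infty$-functions $\alpha_1,\alpha_2,\alpha_3$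 and a $\mathcal K$-function $\sigma$ such that, for all $(x,w)\in\mathbb X\times\mathbb W$, $$\alpha_1(\|x\|)\le V^*(x)\le\alpha_2(\|x\|),\qquad V^*(f(x,w))-V^*(x)\le-\alpha_3(\|x\|)+\sigma(\|w\|).$$ The closed-loop system is input-to-state stable with region of attraction $\mathbb X$: there are a $\mathcal{KL}$-function $\beta$ and a $\mathcal K$-function $\gamma$ such that, for all $k\in\mathbb N$, all $x_0\in\mathbb X$ and all $w_0,\dots,w_{k-1}\in\mathbb W$, $$x_k\in\mathbb X\quad\text{and}\quad \|x_k\|\le\beta(\|x_0\|,k)+\gamma\Bigl(\max_{0\le j\le k-1}\|w_j\|\Bigr),$$ where the maximum is $0$ for $k=0$. -/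

import Mathlib

open MeasureTheory ProbabilityTheory Filter Topology
open scoped NNReal Matrix

noncomputable section

namespace StripedMPC

/-- Real column vectors, with the Euclidean norm. -/
abbrev Vec (n : ℕ) : Type := EuclideanSpace ℝ (Fin n)

/-! ### Comparison functions, input-to-state stability, ISS-Lyapunov functions -/

/-- Class `𝒦`: continuous, strictly increasing, zero at zero. -/
structure IsClassK (φ : ℝ≥0 → ℝ≥0) : Prop where
  continuous : Continuous φ
  strictMono : StrictMono φ
  map_zero : φ 0 = 0

/-- Class `𝒦_∞`: class `𝒦` and unbounded. -/
structure IsClassKInf (φ : ℝ≥0 → ℝ≥0) : Prop extends IsClassK φ where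
  tendsto_atTop : Tendsto φ atTop atTop

/-- Class `𝒦ℒ`. -/
structure IsClassKL (β : ℝ≥0 → ℝ≥0 → ℝ≥0) : Prop where
  continuous : Continuous (Function.uncurry β)
  classK : ∀ t, IsClassK fun s => β s t
  antitone : ∀ s, Antitone (β s)
  tendsto_zero : ∀ s, Tendsto (β s) atTop (𝓝 0)

/-- The trajectory of `x_{k+1} = f (x_k, w_k)` from the initial state `x₀`. -/
def trajectory {E F : Type*} (f : E → F → E) (x₀ : E) (w : ℕ → F) : ℕ → E
  | 0 => x₀
  | k + 1 => f (trajectory f x₀ w k) (w k)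

/-- Input-to-state stability of `x_{k+1} = f (x_k, w_k)` with region of attraction `X`, for
disturbances in `W`.  The maximum over the empty index set (`k = 0`) is `0`. -/
def IsISS {E F : Type*} [NormedAddCommGroup E] [NormedAddCommGroup F]
    (f : E → F → E) (X : Set E) (W : Set F) : Prop :=
  ∃ (β : ℝ≥0 → ℝ≥0 → ℝ≥0) (γ : ℝ≥0 → ℝ≥0), IsClassKL β ∧ IsClassK γ ∧
    ∀ (k : ℕ) (x₀ : E) (w : ℕ → F), x₀ ∈ X → (∀ j < k, w j ∈ W) →
      trajectory f x₀ w k ∈ X ∧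
      ‖trajectory f x₀ w k‖₊ ≤ β ‖x₀‖₊ k + γ ((Finset.range k).sup fun j => ‖w j‖₊)

/-- `V` is an ISS-Lyapunov function, on the state space `X`, for the system
`x_{k+1} = f (x_k, w_k)` with disturbances in `W`; `f` has to map `X × W` into `X`. -/
def IsISSLyapunov {E F : Type*} [NormedAddCommGroup E] [NormedAddCommGroup F]
    (f : E → F → E) (X : Set E) (W : Set F) (V : E → ℝ) : Prop :=
  (∀ x ∈ X, ∀ w ∈ W, f x w ∈ X) ∧
  ContinuousOn V X ∧
  ∃ α₁ α₂ α₃ σ : ℝ≥0 → ℝ≥0,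
    IsClassKInf α₁ ∧ IsClassKInf α₂ ∧ IsClassKInf α₃ ∧ IsClassK σ ∧
    (∀ x ∈ X, (α₁ ‖x‖₊ : ℝ) ≤ V x ∧ V x ≤ (α₂ ‖x‖₊ : ℝ)) ∧
    (∀ x ∈ X, ∀ w ∈ W, V (f x w) - V x ≤ -(α₃ ‖x‖₊ : ℝ) + (σ ‖w‖₊ : ℝ))

/-! ### Linear-algebraic preliminaries -/

/-- The quadratic form `xᵀ M x`. -/
def quadForm {n : ℕ} (M : Matrix (Fin n) (Fin n) ℝ) (x : Vec n) : ℝ :=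
  x.ofLp ⬝ᵥ M *ᵥ x.ofLp

/-- A convex polyhedral set: the intersection of finitely many closed half-spaces. -/
def IsPolyhedral {E : Type*} [AddCommGroup E] [Module ℝ E] (Z : Set E) : Prop :=
  ∃ (r : ℕ) (a : Fin r → E →ₗ[ℝ] ℝ) (b : Fin r → ℝ), Z = {z | ∀ i, a i z ≤ b i}

/-- Schur stability: all (complex) eigenvalues lie in the open unit disc. -/
def IsSchur {n : ℕ} (M : Matrix (Fin n) (Fin n) ℝ) : Prop :=
  ∀ μ ∈ spectrum ℂ (M.map (algebraMap ℝ ℂ)), ‖μ‖ < 1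

/-- `(A, B)` is stabilizable. -/
def IsStabilizable {n m : ℕ} (A : Matrix (Fin n) (Fin n) ℝ) (B : Matrix (Fin n) (Fin m) ℝ) :
    Prop :=
  ∃ F : Matrix (Fin m) (Fin n) ℝ, IsSchur (A + B * F)

/-! ### The striped affine-disturbance-feedback controller -/

/-- The data of the problem: state dimension `n`, input dimension `m`, disturbance dimension `q`,
`nc` probabilistic constraints, horizon `N`. -/
structure Data (n m q nc N : ℕ) where
  /-- dynamics `x_{k+1} = A x_k + B u_k + D w_k` -/
  A : Matrix (Fin n) (Fin n) ℝ
  B : Matrix (Fin n) (Fin m) ℝ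
  D : Matrix (Fin n) (Fin q) ℝ
  /-- the disturbance set -/
  W : Set (Vec q)
  /-- stage cost weights -/
  Q : Matrix (Fin n) (Fin n) ℝ
  R : Matrix (Fin m) (Fin m) ℝ
  /-- the Riccati matrix and the fixed feedback gain -/
  P : Matrix (Fin n) (Fin n) ℝ
  K : Matrix (Fin m) (Fin n) ℝ
  /-- hard constraint set: `(x_k, u_k) ∈ Z` -/
  Z : Set (Vec n × Vec m)
  /-- probabilistic constraints: `f_jᵀ x_{k+1} + g_jᵀ u_k ≤ h_j` with probability at least `p_j` -/
  f : Fin nc → Vec n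
  g : Fin nc → Vec m
  h : Fin nc → ℝ
  p : Fin nc → ℝ
  /-- tightening parameters of the probabilistic constraints -/
  γ : Fin nc → ℝ
  /-- disturbance feedback gains; only `L 1, …, L N` are used -/
  L : ℕ → Matrix (Fin m) (Fin q) ℝ
  /-- constraint checking horizon beyond `N` -/
  N₂ : ℕ

namespace Data

variable {n m q nc N : ℕ} (S : Data n m q nc N)

/-- The closed-loop matrix `Φ = A + B K`. -/
def Φ : Matrix (Fin n) (Fin n) ℝ := S.A + S.B * S.K

/-- The matrix `R + Bᵀ P B`. -/
def inputWeight : Matrix (Fin m) (Fin m) ℝ := S.R + S.Bᵀ * S.P * S.B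

/-- The decision variable `c_{i|k}`, extended by `0` for `i ≥ N`. -/
def perturbation (c : Fin N → Vec m) (i : ℕ) : Vec m :=
  if hi : i < N then c ⟨i, hi⟩ else 0

/-- The striped disturbance feedback `∑_j L_j w_{i-j|k}` at prediction instant `i`, over all
`1 ≤ j ≤ N` for which `w_{i-j|k}` is one of the past disturbances `w_{0|k}, …, w_{i-1|k}`.  The
feedback starts with delay one, or with delay two (if `L 1 = 0`), and stops after delay
`N - 1` if `L N = 0`. -/
def feedback (w : ℕ → Vec q) (i : ℕ) : Vec m :=
  ∑ j ∈ Finset.Icc 1 (min i N), (S.L j).toEuclideanLin (w (i - j))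

/-- Predicted states `x_{i|k}`, from `x_{0|k} = x`, under the predicted control law
`u_{i|k} = K x_{i|k} + c_{i|k} + ∑_j L_j w_{i-j|k}`. -/
def predState (x : Vec n) (c : Fin N → Vec m) (w : ℕ → Vec q) : ℕ → Vec n
  | 0 => x
  | i + 1 =>
      S.A.toEuclideanLin (predState x c w i)
        + S.B.toEuclideanLin
            (S.K.toEuclideanLin (predState x c w i) + perturbation c i + S.feedback w i)
        + S.D.toEuclideanLin (w i)

/-- Predicted inputs `u_{i|k}`. -/
def predInput (x : Vec n) (c : Fin N → Vec m) (w : ℕ → Vec q) (i : ℕ) : Vec m :=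
  S.K.toEuclideanLin (S.predState x c w i) + perturbation c i + S.feedback w i

/-- The predicted pair `(x_{i|k}, u_{i|k})`. -/
def pred (x : Vec n) (c : Fin N → Vec m) (w : ℕ → Vec q) (i : ℕ) : Vec n × Vec m :=
  (S.predState x c w i, S.predInput x c w i)

/-- The nominal prediction: no disturbances. -/
def nominal (x : Vec n) (c : Fin N → Vec m) (i : ℕ) : Vec n × Vec m :=
  S.pred x c 0 i

/-- The uncertain component of the prediction: the part of `(x_{i|k}, u_{i|k})` that is caused by
the disturbances. -/
def uncertain (w : ℕ → Vec q) (i : ℕ) : Vec n × Vec m :=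
  S.pred 0 0 w i

/-- Worst-case tightening of a constraint set at prediction instant `i`: the pairs that stay in
`C` for all values of the uncertain component. -/
def tighten (C : Set (Vec n × Vec m)) (i : ℕ) : Set (Vec n × Vec m) :=
  {z | ∀ w : ℕ → Vec q, (∀ j, w j ∈ S.W) → z + S.uncertain w i ∈ C}

/-- The polyhedral set `𝕊` of the pairs `(x, u)` with
`f_jᵀ A x + (f_jᵀ B + g_jᵀ) u + γ_j ≤ h_j` for all `j`. -/
def probSet : Set (Vec n × Vec m) :=
  {z | ∀ j, inner ℝ (S.f j) (S.A.toEuclideanLin z.1)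
    + (inner ℝ (S.f j) (S.B.toEuclideanLin z.2) + inner ℝ (S.g j) z.2) + S.γ j ≤ S.h j}

/-- The constraint of the online problem at prediction instant `i`: the nominal prediction lies
in the tightened versions of `𝕊` and of `Z`. -/
def ConstraintAt (x : Vec n) (c : Fin N → Vec m) (i : ℕ) : Prop :=
  S.nominal x c i ∈ S.tighten S.probSet i ∩ S.tighten S.Z i

/-- `c` is feasible for the online problem at the state `x`. -/
def Feasible (x : Vec n) (c : Fin N → Vec m) : Prop :=
  ∀ i < N + S.N₂, S.ConstraintAt x c i

/-- The set `𝕏` of the states for which the online problem is feasible. -/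
def feasibleStates : Set (Vec n) := {x | ∃ c, S.Feasible x c}

/-- The cost `V (x, c) = xᵀ P x + cᵀ P_c c`, where `P_c = I ⊗ (R + Bᵀ P B)` is block diagonal. -/
def cost (x : Vec n) (c : Fin N → Vec m) : ℝ :=
  quadForm S.P x + ∑ i, quadForm S.inputWeight (c i)

/-- `c` solves the online problem at the state `x`. -/
def IsOptimal (x : Vec n) (c : Fin N → Vec m) : Prop :=
  S.Feasible x c ∧ ∀ c', S.Feasible x c' → S.cost x c ≤ S.cost x c'

/-- The closed-loop map `(x, w) ↦ Φ x + B c*_0(x) + D w`. -/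
def closedLoop (cstar : Vec n → Fin N → Vec m) (x : Vec n) (w : Vec q) : Vec n :=
  S.Φ.toEuclideanLin x + S.B.toEuclideanLin (perturbation (cstar x) 0) + S.D.toEuclideanLin w

/-- The optimal value `V*(x) = V (x, c*(x))`. -/
def optimalValue (cstar : Vec n → Fin N → Vec m) (x : Vec n) : ℝ :=
  S.cost x (cstar x)

/-- Standing assumptions on the data and on the disturbance process `w`. -/
structure Admissible {Ω : Type*} [MeasurableSpace Ω] (Pr : Measure Ω) (w : ℕ → Ω → Vec q) :
    Prop where
  horizon_pos : 0 < N
  stabilizable : IsStabilizable S.A S.B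
  W_bounded : Bornology.IsBounded S.W
  W_zero : 0 ∈ interior S.W
  w_measurable : ∀ k, Measurable (w k)
  w_indep : iIndepFun w Pr
  w_identDistrib : ∀ k, IdentDistrib (w k) (w 0) Pr Pr
  w_support : ∀ k, ∀ᵐ ω ∂Pr, w k ω ∈ S.W
  w_mean : ∀ k, ∫ ω, w k ω ∂Pr = 0
  w_small : ∀ k, ∀ r : ℝ, 0 < r → 0 < Pr {ω | ‖w k ω‖ ≤ r}
  Q_posDef : S.Q.PosDef
  R_posDef : S.R.PosDef
  P_posDef : S.P.PosDef
  riccati : S.P = S.Q + S.Aᵀ * S.P * S.A - S.Kᵀ * S.inputWeight * S.K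
  gain : S.K = -(S.inputWeight⁻¹ * S.Bᵀ * S.P * S.A)
  Z_polyhedral : IsPolyhedral S.Z
  Z_compact : IsCompact S.Z
  Z_zero : 0 ∈ interior S.Z
  p_mem : ∀ j, S.p j ∈ Set.Ioc (0 : ℝ) 1
  /-- The tightened constraint with parameter `γ_j` ensures the probabilistic one. -/
  γ_spec : ∀ j x u,
    inner ℝ (S.f j) (S.A.toEuclideanLin x)
      + (inner ℝ (S.f j) (S.B.toEuclideanLin u) + inner ℝ (S.g j) u) + S.γ j ≤ S.h j →
    ∀ k, S.p j ≤ Pr.real {ω | inner ℝ (S.f j)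
      (S.A.toEuclideanLin x + S.B.toEuclideanLin u + S.D.toEuclideanLin (w k ω))
        + inner ℝ (S.g j) u ≤ S.h j}
  /-- `N₂` is so large that the constraints of the online problem imply those at all later
  prediction instants. -/
  N₂_spec : ∀ x c, S.Feasible x c → ∀ i, N ≤ i → S.ConstraintAt x c i

end Data

end StripedMPC

end

/-!
The controller is a parametric quadratic program over the graph of the feasible perturbations,
`S.feasibleGraph`, a compact convex set, and the theorem rests on quadratic bounds for its optimal
value.

*Continuity and the upper bound.* The origin need not be an interior point of the set of feasible
states, so both are obtained from the polyhedral nature of the constraints, of which, besides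
convexity and closedness, only one consequence matters: points of the graph near a point `z` of it
may be doubled about `z` (`IsLocallyConic`). Every tightened half-space has this property,
being the preimage of a lower set of `ℝ`, hence so has the graph. By `exists_lipschitz_selection`
the feasible fibres then admit, through each point of the graph, a selection that is Lipschitz at
that point. Through a minimizer it
yields continuity of the optimal value (`continuousOn_optimalValue`); through `(0, 0)` it yields the
bound `V* x ≤ C ‖x‖ ^ 2` (`Data.Admissible.exists_cost_le`). That `(0, 0)` is feasible as soon as
some state is follows because the nominal predictions tend to zero and satisfy all the tightened
constraints, which are closed and become more severe with time (`Data.Admissible.feasible_zero`).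

*Decrease.* The predictions from the successor state, with the tail of `c` corrected by the feedback
of the realized disturbance, are the old predictions with their first disturbance fixed
(`Data.pred_delay`). This gives recursive feasibility. By the Riccati equation the cost of this
candidate is at most `V - xᵀ Q x`, up to a term that is linear in the disturbance because all the
quantities involved are bounded (`Data.Admissible.exists_cost_shift_le`).

*Stability.* With `a ‖x‖ ^ 2 ≤ V* x ≤ C ‖x‖ ^ 2` the decrease is a geometric contraction up to a
multiple of `‖w‖`, from which explicit comparison functions are read off (`isISS_of_quadratic`).
-/

namespace StripedMPC

/-! ### Comparison functions and input-to-state stability -/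

theorem isClassKInf_const_mul_pow {a : ℝ≥0} (ha : 0 < a) {p : ℕ} (hp : p ≠ 0) :
    IsClassKInf fun s => a * s ^ p where
  continuous := by fun_prop
  strictMono := fun s t h =>
    mul_lt_mul_of_pos_left (pow_lt_pow_left₀ h zero_le hp) ha
  map_zero := by simp [hp]
  tendsto_atTop := (tendsto_pow_atTop hp).const_mul_atTop ha

theorem isClassK_const_mul {a : ℝ≥0} (ha : 0 < a) : IsClassK fun s => a * s := by
  simpa using (isClassKInf_const_mul_pow ha one_ne_zero).toIsClassK

theorem isClassK_sqrt_const_mul {a : ℝ≥0} (ha : 0 < a) :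
    IsClassK fun s => NNReal.sqrt (a * s) where
  continuous := by fun_prop
  strictMono := fun s t h =>
    NNReal.sqrt_lt_sqrt.2 (mul_lt_mul_of_pos_left h ha)
  map_zero := by simp

theorem isClassKL_mul_rpow {b r : ℝ≥0} (hb : 0 < b) (hr : 0 < r) (hr1 : r < 1) :
    IsClassKL fun s t => b * s * r ^ (t : ℝ) where
  continuous := by
    have h : Continuous fun t : ℝ≥0 => r ^ (t : ℝ) :=
      continuous_iff_continuousAt.2 fun t =>
        (NNReal.continuousAt_rpow (Or.inl hr.ne')).comp
          (f := fun t : ℝ≥0 => (r, (t : ℝ))) (by fun_prop)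
    exact ((continuous_const.mul continuous_fst).mul (h.comp continuous_snd))
  classK t := by
    have h := isClassK_const_mul (a := b * r ^ (t : ℝ)) (mul_pos hb (NNReal.rpow_pos hr))
    simpa [mul_right_comm] using h
  antitone s t u h := by
    dsimp only
    gcongr 1
    exact NNReal.rpow_le_rpow_of_exponent_ge hr hr1.le (by exact_mod_cast h)
  tendsto_zero s := by
    have h : Tendsto (fun t : ℝ≥0 => r ^ (t : ℝ)) atTop (𝓝 0) := by
      rw [← NNReal.tendsto_coe]
      simp only [NNReal.coe_rpow]
      exact (tendsto_rpow_atTop_of_base_lt_one _ (by linarith [r.2, show (0:ℝ) < r from hr])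
        (by exact_mod_cast hr1)).comp (NNReal.tendsto_coe_atTop.2 tendsto_id)
    simpa using h.const_mul (b * s)

/-- A function `V` with quadratic lower and upper bounds that decreases by a multiple of `‖x‖ ^ 2`,
up to an error linear in `‖w‖`, certifies input-to-state stability: it contracts geometrically up
to that error, so `β` may be taken exponential in time and `γ` a square root. -/
theorem isISS_of_quadratic {E F : Type*} [NormedAddCommGroup E] [NormedAddCommGroup F]
    {f : E → F → E} {X : Set E} {W : Set F} {V : E → ℝ} {a C q ℓ : ℝ≥0}
    (ha : 0 < a) (hC : 0 < C) (hq : 0 < q) (hℓ : 0 < ℓ)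
    (hmap : ∀ x ∈ X, ∀ w ∈ W, f x w ∈ X)
    (hlow : ∀ x ∈ X, a * ‖x‖ ^ 2 ≤ V x) (hup : ∀ x ∈ X, V x ≤ C * ‖x‖ ^ 2)
    (hdec : ∀ x ∈ X, ∀ w ∈ W, V (f x w) ≤ V x - q * ‖x‖ ^ 2 + ℓ * ‖w‖) :
    IsISS f X W := by
  -- The contraction rate is `ρ = 1 - q / (C + q)`; the enlarged denominator keeps it positive.
  -- The error then accumulates to at most `d * M`, where `d = ℓ / (1 - ρ)`.
  set ρ : ℝ≥0 := C / (C + q) with hρ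
  set d : ℝ≥0 := ℓ * (C + q) / q with hd
  have hρ0 : 0 < ρ := by positivity
  have hρ1 : ρ < 1 := by
    rw [hρ, div_lt_one (by positivity)]
    exact lt_add_of_pos_right C hq
  have hd0 : 0 < d := by positivity
  have ha' : (0 : ℝ) < a := ha
  have hC' : (0 : ℝ) < C := hC
  have hq' : (0 : ℝ) < q := hq
  refine ⟨fun s t => NNReal.sqrt (C / a) * s * NNReal.sqrt ρ ^ (t : ℝ),
    fun s => NNReal.sqrt (d / a * s),
    isClassKL_mul_rpow (NNReal.sqrt_pos.2 (by positivity)) (NNReal.sqrt_pos.2 hρ0)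
      (by simpa using NNReal.sqrt_lt_sqrt.2 hρ1),
    isClassK_sqrt_const_mul (by positivity), ?_⟩
  intro k x₀ w hx₀ hw
  set M : ℝ≥0 := (Finset.range k).sup fun j => ‖w j‖₊ with hM
  have key : ∀ j ≤ k, trajectory f x₀ w j ∈ X ∧
      V (trajectory f x₀ w j) ≤ (ρ : ℝ) ^ j * (C * ‖x₀‖ ^ 2) + d * M := by
    intro j
    induction j with
    | zero =>
      intro _
      have : (0 : ℝ) ≤ d * M := by positivity
      exact ⟨hx₀, by simpa [trajectory] using (hup x₀ hx₀).trans (by linarith)⟩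
    | succ j ih =>
      intro hj
      obtain ⟨hX, hV⟩ := ih (by omega)
      have hwj : ‖w j‖ ≤ M := by
        exact_mod_cast Finset.le_sup (f := fun j => ‖w j‖₊) (Finset.mem_range.2 (by omega))
      refine ⟨hmap _ hX _ (hw j (by omega)), (hdec _ hX _ (hw j (by omega))).trans ?_⟩
      set x := trajectory f x₀ w j
      have h1 := hup x hX
      have h0 : 0 ≤ V x := le_trans (by positivity) (hlow x hX)
      have hρV : V x - q * ‖x‖ ^ 2 ≤ ρ * V x := by
        rw [hρ]
        push_cast
        rw [div_mul_eq_mul_div, le_div_iff₀ (by positivity)]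
        nlinarith [mul_nonneg hq'.le (sq_nonneg ‖x‖)]
      have hM1 : (ℓ : ℝ) * ‖w j‖ ≤ ℓ * M := by gcongr
      have hρd : (ρ : ℝ) * (d * M) + ℓ * M = d * M := by
        rw [hρ, hd]
        push_cast
        field_simp
      have h2 := mul_le_mul_of_nonneg_left hV ρ.coe_nonneg
      rw [pow_succ' (ρ : ℝ) j]
      linarith
  obtain ⟨hX, hV⟩ := key k le_rfl
  refine ⟨hX, ?_⟩
  rw [← NNReal.coe_le_coe]
  push_cast
  have h3 := (hlow _ hX).trans hV
  -- Square roots are taken termwise, by `√(s + t) ≤ √s + √t` in squared form.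
  have h4 : ‖trajectory f x₀ w k‖ ^ 2 ≤
      (√(C / a : ℝ) * ‖x₀‖ * √(ρ : ℝ) ^ k) ^ 2 + (√(d / a * M : ℝ)) ^ 2 := by
    rw [Real.sq_sqrt (by positivity), mul_pow, mul_pow, Real.sq_sqrt (by positivity), ← pow_mul,
      mul_comm k 2, pow_mul, Real.sq_sqrt (by positivity)]
    rw [← mul_le_mul_iff_right₀ ha']
    refine h3.trans (le_of_eq ?_)
    field_simp
  simp only [Real.rpow_natCast]
  refine le_of_sq_le_sq ?_ (by positivity)
  nlinarith [mul_nonneg (show 0 ≤ √(C / a : ℝ) * ‖x₀‖ * √(ρ : ℝ) ^ k by positivity)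
    (Real.sqrt_nonneg (d / a * M : ℝ))]

/-! ### Locally conic sets -/

/-- A set `C` is locally conic if each of its points `z` has a neighbourhood in `C` that may be
scaled by the factor `2` about `z` without leaving `C`. Convex polyhedra have this property, a
closed disc in the plane does not. -/
def IsLocallyConic {E : Type*} [AddCommGroup E] [Module ℝ E] [TopologicalSpace E]
    (C : Set E) : Prop :=
  ∀ z ∈ C, ∀ᶠ z' in 𝓝[C] z, (2 : ℝ) • z' - z ∈ C

theorem isLocallyConic_of_isLowerSet {T : Set ℝ} (hT : IsLowerSet T) : IsLocallyConic T := by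
  intro t ht
  by_cases h : ∃ s ∈ T, t < s
  · obtain ⟨s, hs, hts⟩ := h
    have hc : Tendsto (fun t' : ℝ => (2 : ℝ) • t' - t) (𝓝[T] t) (𝓝 t) := by
      refine (Continuous.tendsto' (by fun_prop) _ _ ?_).mono_left nhdsWithin_le_nhds
      simp only [smul_eq_mul]
      ring
    filter_upwards [hc.eventually (gt_mem_nhds hts)] with t' ht'
    exact hT ht'.le hs
  · push Not at h
    filter_upwards [self_mem_nhdsWithin] with t' ht'
    refine hT ?_ ht
    have := h t' ht'
    simp only [smul_eq_mul]
    linarith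

section LocallyConic

variable {E G : Type*} [AddCommGroup E] [Module ℝ E] [TopologicalSpace E]
  [AddCommGroup G] [Module ℝ G] [TopologicalSpace G]

theorem IsLocallyConic.preimage {C : Set G} (hC : IsLocallyConic C) (φ : E →L[ℝ] G) :
    IsLocallyConic (φ ⁻¹' C) := by
  intro z hz
  have h : Tendsto φ (𝓝[φ ⁻¹' C] z) (𝓝[C] (φ z)) :=
    φ.continuous.continuousWithinAt.tendsto_nhdsWithin fun _ h => h
  filter_upwards [h.eventually (hC _ hz)] with z' hz'
  simpa using hz'

theorem IsLocallyConic.iInter {ι : Sort*} [Finite ι] {C : ι → Set E}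
    (hC : ∀ i, IsLocallyConic (C i)) : IsLocallyConic (⋂ i, C i) := by
  intro z hz
  have h : ∀ i, ∀ᶠ z' in 𝓝[⋂ i, C i] z, (2 : ℝ) • z' - z ∈ C i := fun i =>
    nhdsWithin_mono _ (Set.iInter_subset _ i) (hC i z (Set.mem_iInter.1 hz i))
  filter_upwards [eventually_all.2 h] with z' hz'
  exact Set.mem_iInter.2 hz'

theorem IsLocallyConic.inter {C C' : Set E} (hC : IsLocallyConic C) (hC' : IsLocallyConic C') :
    IsLocallyConic (C ∩ C') := by
  rw [Set.inter_eq_iInter]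
  exact .iInter (Bool.forall_bool.2 ⟨hC', hC⟩)

end LocallyConic

/-- Through every point of a compact, convex, locally conic subset of a product there passes a
selection of the fibres that is Lipschitz at that point. By compactness the doubling property
passes to the projection of the set; a point whose projection is close to `x₀` is doubled until it
is at a distance bounded below, where the claim is trivial, and scaled back by convexity. -/
theorem exists_lipschitz_selection {E G : Type*} [NormedAddCommGroup E] [NormedSpace ℝ E]
    [NormedAddCommGroup G] [NormedSpace ℝ G] {F : Set (E × G)} (hconv : Convex ℝ F)
    (hcomp : IsCompact F) (hF : IsLocallyConic F) {x₀ : E} {c₀ : G} (h₀ : (x₀, c₀) ∈ F) :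
    ∃ C : ℝ, 0 < C ∧ ∀ x c, (x, c) ∈ F → ∃ c', (x, c') ∈ F ∧ ‖c' - c₀‖ ≤ C * ‖x - x₀‖ := by
  have hdouble : ∀ᶠ x in 𝓝 x₀, ∀ c, (x, c) ∈ F → ∃ c', ((2 : ℝ) • x - x₀, c') ∈ F := by
    refine hcomp.induction_on
      (p := fun s => ∀ᶠ x in 𝓝 x₀, ∀ c, (x, c) ∈ s → ∃ c', ((2 : ℝ) • x - x₀, c') ∈ F)
      (by simp) ?_ ?_ ?_
    · intro s t hst h
      filter_upwards [h] with x hx c hc using hx c (hst hc)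
    · intro s t hs ht
      filter_upwards [hs, ht] with x hx hx' c hc using hc.elim (hx c) (hx' c)
    -- Over `x₀` itself local conicity applies; elsewhere the projection stays away from `x₀`.
    · rintro ⟨x, c⟩ hxc
      rcases eq_or_ne x x₀ with rfl | hne
      · refine ⟨_, hF _ hxc, .of_forall fun y d hd => ?_⟩
        exact ⟨_, hd⟩
      · obtain ⟨u, v, hu, hv, hxu, hxv, huv⟩ := t2_separation hne
        refine ⟨Prod.fst ⁻¹' u, mem_nhdsWithin_of_mem_nhds
          ((hu.preimage continuous_fst).mem_nhds hxu), ?_⟩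
        filter_upwards [hv.mem_nhds hxv] with y hy d hd
        exact (Set.disjoint_left.1 huv hd hy).elim
  obtain ⟨η, hη, hball⟩ := Metric.eventually_nhds_iff.1 hdouble
  obtain ⟨M, hM⟩ := hcomp.isBounded.exists_norm_le
  have hM0 : 0 ≤ M := (norm_nonneg _).trans (hM _ h₀)
  -- `C * η` exceeds the diameter of `F`, so at distance `η` from `x₀` every selection will do.
  set C := (2 * M + 1) / η with hC
  refine ⟨C, by positivity, ?_⟩
  -- Induction on the number of doublings that bring `x` to distance `η`.
  have key : ∀ k : ℕ, ∀ x c, (x, c) ∈ F → η ≤ 2 ^ k * ‖x - x₀‖ →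
      ∃ c', (x, c') ∈ F ∧ ‖c' - c₀‖ ≤ C * ‖x - x₀‖ := by
    have far : ∀ x c, (x, c) ∈ F → η ≤ ‖x - x₀‖ → ‖c - c₀‖ ≤ C * ‖x - x₀‖ := by
      intro x c hxc hx
      have h1 : ‖c‖ ≤ M := (norm_snd_le (x, c)).trans (hM _ hxc)
      have h2 : ‖c₀‖ ≤ M := (norm_snd_le (x₀, c₀)).trans (hM _ h₀)
      have h3 : C * η = 2 * M + 1 := by rw [hC]; field_simp
      have h4 : C * η ≤ C * ‖x - x₀‖ := by gcongr
      linarith [norm_sub_le c c₀]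
    intro k
    induction k with
    | zero => exact fun x c hxc hx => ⟨c, hxc, far x c hxc (by simpa using hx)⟩
    | succ k ih =>
      intro x c hxc hx
      rcases le_or_gt η ‖x - x₀‖ with hfar | hnear
      · exact ⟨c, hxc, far x c hxc hfar⟩
      obtain ⟨c₁, hc₁⟩ := hball (by rwa [dist_eq_norm]) c hxc
      have hsub : (2 : ℝ) • x - x₀ - x₀ = (2 : ℝ) • (x - x₀) := by module
      have hnorm : ‖(2 : ℝ) • x - x₀ - x₀‖ = 2 * ‖x - x₀‖ := by
        rw [hsub, norm_smul]; norm_num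
      obtain ⟨c₂, hc₂, hle⟩ := ih _ c₁ hc₁ (by rw [hnorm, ← mul_assoc, ← pow_succ]; exact hx)
      refine ⟨(1 / 2 : ℝ) • c₂ + (1 / 2 : ℝ) • c₀, ?_, ?_⟩
      · have := hconv hc₂ h₀ (a := 1 / 2) (b := 1 / 2) (by norm_num) (by norm_num) (by norm_num)
        convert this using 1
        ext1
        · simp only [Prod.smul_mk, Prod.mk_add_mk]; module
        · simp only [Prod.smul_mk, Prod.mk_add_mk]
      · have : (1 / 2 : ℝ) • c₂ + (1 / 2 : ℝ) • c₀ - c₀ = (1 / 2 : ℝ) • (c₂ - c₀) := by module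
        rw [this, norm_smul]
        rw [hnorm] at hle
        norm_num
        linarith
  intro x c hxc
  rcases eq_or_ne x x₀ with rfl | hne
  · exact ⟨c₀, h₀, by simp⟩
  · have hpos : 0 < ‖x - x₀‖ := norm_pos_iff.2 (sub_ne_zero.2 hne)
    obtain ⟨k, hk⟩ := pow_unbounded_of_one_lt (η / ‖x - x₀‖) (one_lt_two (α := ℝ))
    exact key k x c hxc ((div_le_iff₀ hpos).1 hk.le)

/-- Local conicity at the minimizers makes the optimal value of a parametric minimization problem
continuous: compactness gives lower semicontinuity, the Lipschitz selection through a minimizer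
gives upper semicontinuity. -/
theorem continuousOn_optimalValue {E G : Type*} [NormedAddCommGroup E] [NormedSpace ℝ E]
    [NormedAddCommGroup G] [NormedSpace ℝ G] {F : Set (E × G)} (hconv : Convex ℝ F)
    (hcomp : IsCompact F) (hF : IsLocallyConic F) {J : E × G → ℝ} (hJ : Continuous J)
    {s : E → G} {X : Set E} (hs : ∀ x ∈ X, (x, s x) ∈ F)
    (hopt : ∀ x ∈ X, ∀ c, (x, c) ∈ F → J (x, s x) ≤ J (x, c)) :
    ContinuousOn (fun x => J (x, s x)) X := by
  intro x₀ hx₀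
  obtain ⟨C, -, hC⟩ := exists_lipschitz_selection hconv hcomp hF (hs x₀ hx₀)
  choose! g hgF hg using fun x (hx : x ∈ X) => hC x (s x) (hs x hx)
  refine (tendsto_iff_ultrafilter _ _ _).2 fun u hu => ?_
  have huX : ∀ᶠ x in (u : Filter E), x ∈ X := hu self_mem_nhdsWithin
  have hux : Tendsto id (u : Filter E) (𝓝 x₀) := hu.trans nhdsWithin_le_nhds
  have hug : Tendsto g (u : Filter E) (𝓝 (s x₀)) := by
    rw [tendsto_iff_norm_sub_tendsto_zero]
    have h0 : Tendsto (fun x => C * ‖x - x₀‖) (u : Filter E) (𝓝 0) := by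
      simpa using (tendsto_iff_norm_sub_tendsto_zero.1 hux).const_mul C
    exact squeeze_zero' (.of_forall fun _ => norm_nonneg _) (huX.mono fun x hx => hg x hx) h0
  obtain ⟨⟨x₁, c₁⟩, hF₁, hlim⟩ := hcomp.ultrafilter_le_nhds (u.map fun x => (x, s x))
    (le_principal_iff.2 (huX.mono fun x hx => hs x hx))
  have hlim' : Tendsto (fun x => (x, s x)) (u : Filter E) (𝓝 (x₁, c₁)) := hlim
  obtain rfl : x₀ = x₁ := tendsto_nhds_unique hux ((continuous_fst.tendsto _).comp hlim')
  have h1 : Tendsto (fun x => J (x, s x)) u (𝓝 (J (x₀, c₁))) := (hJ.tendsto _).comp hlim'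
  have h2 : Tendsto (fun x => J (x, g x)) u (𝓝 (J (x₀, s x₀))) :=
    (hJ.tendsto _).comp (hux.prodMk_nhds hug)
  have hle : J (x₀, c₁) ≤ J (x₀, s x₀) :=
    le_of_tendsto_of_tendsto h1 h2 (huX.mono fun x hx => hopt x hx _ (hgF x hx))
  have heq : J (x₀, c₁) = J (x₀, s x₀) := le_antisymm hle (hopt x₀ hx₀ _ hF₁)
  simpa only [← heq] using h1

/-! ### Quadratic forms -/

section QuadForm

variable {n m : ℕ}

theorem quadForm_zero (M : Matrix (Fin n) (Fin n) ℝ) : quadForm M 0 = 0 := by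
  simp [quadForm]

theorem continuous_quadForm (M : Matrix (Fin n) (Fin n) ℝ) : Continuous (quadForm M) := by
  unfold quadForm
  fun_prop

theorem quadForm_smul (M : Matrix (Fin n) (Fin n) ℝ) (t : ℝ) (x : Vec n) :
    quadForm M (t • x) = t ^ 2 * quadForm M x := by
  simp only [quadForm, WithLp.ofLp_smul, Matrix.mulVec_smul, smul_dotProduct, dotProduct_smul,
    smul_eq_mul]
  ring

theorem quadForm_midpoint (M : Matrix (Fin n) (Fin n) ℝ) (x y : Vec n) :
    quadForm M ((1 / 2 : ℝ) • x + (1 / 2 : ℝ) • y)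
      = quadForm M x / 2 + quadForm M y / 2 - quadForm M (x - y) / 4 := by
  simp only [quadForm, WithLp.ofLp_smul, WithLp.ofLp_add, WithLp.ofLp_sub, Matrix.mulVec_smul,
    Matrix.mulVec_add, Matrix.mulVec_sub, smul_dotProduct, dotProduct_smul, add_dotProduct,
    dotProduct_add, sub_dotProduct, dotProduct_sub, smul_eq_mul]
  ring

theorem quadForm_pos {M : Matrix (Fin n) (Fin n) ℝ} (hM : M.PosDef) {x : Vec n} (hx : x ≠ 0) :
    0 < quadForm M x := by
  have := hM.dotProduct_mulVec_pos (x := x.ofLp) (by simpa using hx)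
  simpa [quadForm] using this

theorem quadForm_nonneg {M : Matrix (Fin n) (Fin n) ℝ} (hM : M.PosDef) (x : Vec n) :
    0 ≤ quadForm M x := by
  rcases eq_or_ne x 0 with rfl | hx
  · rw [quadForm_zero]
  · exact (quadForm_pos hM hx).le

theorem exists_mul_sq_le_quadForm {M : Matrix (Fin n) (Fin n) ℝ} (hM : M.PosDef) :
    ∃ a : ℝ≥0, 0 < a ∧ ∀ x, a * ‖x‖ ^ 2 ≤ quadForm M x := by
  rcases (Metric.sphere (0 : Vec n) 1).eq_empty_or_nonempty with he | hne
  · refine ⟨1, one_pos, fun x => ?_⟩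
    rcases eq_or_ne x 0 with rfl | hx
    · simp [quadForm_zero]
    · have : ‖x‖⁻¹ • x ∈ Metric.sphere (0 : Vec n) 1 := by
        simp [norm_smul, norm_ne_zero_iff.2 hx]
      simp [he] at this
  · obtain ⟨z, hz, hmin⟩ := (isCompact_sphere (0 : Vec n) 1).exists_isMinOn hne
      (continuous_quadForm M).continuousOn
    have hz0 : z ≠ 0 := by
      rintro rfl
      simp at hz
    refine ⟨⟨quadForm M z, quadForm_nonneg hM z⟩, quadForm_pos hM hz0, fun x => ?_⟩
    change quadForm M z * ‖x‖ ^ 2 ≤ _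
    rcases eq_or_ne x 0 with rfl | hx
    · simp [quadForm_zero]
    · have hx' : ‖x‖ ≠ 0 := norm_ne_zero_iff.2 hx
      have h : quadForm M z ≤ quadForm M (‖x‖⁻¹ • x) :=
        hmin (by simp [norm_smul, hx'])
      rw [quadForm_smul, inv_pow, inv_mul_eq_div, le_div_iff₀ (by positivity)] at h
      exact h

theorem exists_abs_dotProduct_mulVec_le (M : Matrix (Fin n) (Fin n) ℝ) :
    ∃ C : ℝ, 0 ≤ C ∧ ∀ x y : Vec n, |x.ofLp ⬝ᵥ M *ᵥ y.ofLp| ≤ C * ‖x‖ * ‖y‖ := by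
  refine ⟨‖M.toEuclideanLin.toContinuousLinearMap‖, norm_nonneg _, fun x y => ?_⟩
  have h : x.ofLp ⬝ᵥ M *ᵥ y.ofLp = inner ℝ x (M.toEuclideanLin.toContinuousLinearMap y) := by
    simp [EuclideanSpace.inner_eq_star_dotProduct, dotProduct_comm, Matrix.toLpLin_apply]
  rw [h]
  refine (abs_real_inner_le_norm _ _).trans ?_
  have := M.toEuclideanLin.toContinuousLinearMap.le_opNorm y
  calc _ ≤ ‖x‖ * (‖M.toEuclideanLin.toContinuousLinearMap‖ * ‖y‖) := by gcongr
    _ = _ := by ring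

theorem exists_quadForm_le (M : Matrix (Fin n) (Fin n) ℝ) :
    ∃ C : ℝ, 0 ≤ C ∧ ∀ x, quadForm M x ≤ C * ‖x‖ ^ 2 := by
  obtain ⟨C, hC, h⟩ := exists_abs_dotProduct_mulVec_le M
  exact ⟨C, hC, fun x => (le_abs_self _).trans ((h x x).trans_eq (by ring))⟩

theorem exists_norm_toEuclideanLin_le (T : Matrix (Fin n) (Fin m) ℝ) :
    ∃ C : ℝ, 0 ≤ C ∧ ∀ x, ‖T.toEuclideanLin x‖ ≤ C * ‖x‖ :=
  ⟨‖T.toEuclideanLin.toContinuousLinearMap‖, norm_nonneg _,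
    fun x => T.toEuclideanLin.toContinuousLinearMap.le_opNorm x⟩

/-- On bounded sets, a perturbation `T w` of the argument changes a quadratic form by at most a
multiple of `‖w‖`. -/
theorem exists_quadForm_add_le (M : Matrix (Fin n) (Fin n) ℝ) (T : Matrix (Fin n) (Fin m) ℝ)
    (r₁ r₂ : ℝ) :
    ∃ ℓ : ℝ, 0 ≤ ℓ ∧ ∀ (x : Vec n) (w : Vec m), ‖x‖ ≤ r₁ → ‖w‖ ≤ r₂ →
      quadForm M (x + T.toEuclideanLin w) ≤ quadForm M x + ℓ * ‖w‖ := by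
  obtain ⟨C, hC, hM⟩ := exists_abs_dotProduct_mulVec_le M
  obtain ⟨D, hD, hT⟩ := exists_norm_toEuclideanLin_le T
  refine ⟨2 * C * |r₁| * D + C * D ^ 2 * |r₂|, by positivity, fun x w hx hw => ?_⟩
  have hx := hx.trans (le_abs_self r₁)
  have hw := hw.trans (le_abs_self r₂)
  set y := T.toEuclideanLin w
  have hexp : quadForm M (x + y) = quadForm M x + x.ofLp ⬝ᵥ M *ᵥ y.ofLp
      + y.ofLp ⬝ᵥ M *ᵥ x.ofLp + y.ofLp ⬝ᵥ M *ᵥ y.ofLp := by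
    simp only [quadForm, WithLp.ofLp_add, Matrix.mulVec_add, add_dotProduct, dotProduct_add]
    ring
  have h1 : x.ofLp ⬝ᵥ M *ᵥ y.ofLp ≤ C * |r₁| * (D * ‖w‖) :=
    (le_abs_self _).trans ((hM x y).trans (by gcongr; exact hT w))
  have h2 : y.ofLp ⬝ᵥ M *ᵥ x.ofLp ≤ C * (D * ‖w‖) * |r₁| :=
    (le_abs_self _).trans ((hM y x).trans (by gcongr; exact hT w))
  have h3 : y.ofLp ⬝ᵥ M *ᵥ y.ofLp ≤ C * (D * ‖w‖) * (D * |r₂|) :=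
    (le_abs_self _).trans ((hM y y).trans
      (by gcongr; exacts [hT w, (hT w).trans (by gcongr)]))
  rw [hexp]
  linarith

end QuadForm

/-! ### The Riccati equation -/

namespace Data

variable {n m q nc N : ℕ} {S : Data n m q nc N}
variable {Ω : Type*} [MeasurableSpace Ω] {Pr : Measure Ω} {w : ℕ → Ω → Vec q}

theorem Admissible.inputWeight_posDef (hS : S.Admissible Pr w) : S.inputWeight.PosDef := by
  have h := hS.P_posDef.posSemidef.conjTranspose_mul_mul_same S.B
  simpa [inputWeight] using hS.R_posDef.add_posSemidef h

theorem Admissible.transpose_P (hS : S.Admissible Pr w) : S.Pᵀ = S.P := by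
  simpa using hS.P_posDef.isHermitian.eq

theorem Admissible.transpose_R (hS : S.Admissible Pr w) : S.Rᵀ = S.R := by
  simpa using hS.R_posDef.isHermitian.eq

theorem Admissible.transpose_inputWeight (hS : S.Admissible Pr w) :
    S.inputWeightᵀ = S.inputWeight := by
  simpa using hS.inputWeight_posDef.isHermitian.eq

theorem Admissible.transpose_B_mul_P_mul_A (hS : S.Admissible Pr w) :
    S.Bᵀ * S.P * S.A = -(S.inputWeight * S.K) := by
  have h : S.inputWeight * S.inputWeight⁻¹ = 1 :=
    Matrix.mul_nonsing_inv _ ((Matrix.isUnit_iff_isUnit_det _).1 hS.inputWeight_posDef.isUnit)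
  rw [hS.gain, Matrix.mul_neg, neg_neg, ← Matrix.mul_assoc, ← Matrix.mul_assoc,
    ← Matrix.mul_assoc, h, Matrix.one_mul]

theorem Admissible.transpose_B_mul_P_mul_Φ (hS : S.Admissible Pr w) :
    S.Bᵀ * S.P * S.Φ = -(S.R * S.K) := by
  have hB : S.Bᵀ * S.P * S.B = S.inputWeight - S.R := by simp [inputWeight]
  rw [Φ, Matrix.mul_add, hS.transpose_B_mul_P_mul_A, ← Matrix.mul_assoc, hB, Matrix.sub_mul]
  abel

theorem Admissible.transpose_Φ_mul_P_mul_B (hS : S.Admissible Pr w) :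
    S.Φᵀ * S.P * S.B = -(S.Kᵀ * S.R) := by
  have := congrArg Matrix.transpose hS.transpose_B_mul_P_mul_Φ
  simpa [Matrix.transpose_mul, hS.transpose_P, hS.transpose_R, Matrix.mul_assoc] using this

theorem Admissible.transpose_Φ_mul_P_mul_Φ (hS : S.Admissible Pr w) :
    S.Φᵀ * S.P * S.Φ = S.P - S.Q - S.Kᵀ * S.R * S.K := by
  have h1 : S.Aᵀ * S.P * S.B = -(S.Kᵀ * S.inputWeight) := by
    have := congrArg Matrix.transpose hS.transpose_B_mul_P_mul_A
    simpa [Matrix.transpose_mul, hS.transpose_P, hS.transpose_inputWeight, Matrix.mul_assoc]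
      using this
  have h2 : S.Aᵀ * S.P * S.A = S.P - S.Q + S.Kᵀ * S.inputWeight * S.K := by
    have h := hS.riccati
    nth_rewrite 2 [h]
    abel
  have h3 : S.Φᵀ * S.P * S.Φ
      = S.Aᵀ * S.P * S.A + S.Aᵀ * S.P * S.B * S.K + S.Kᵀ * (S.Bᵀ * S.P * S.Φ) := by
    simp only [Φ, Matrix.transpose_add, Matrix.transpose_mul, Matrix.mul_add, Matrix.add_mul,
      Matrix.mul_assoc]
    abel
  rw [h3, hS.transpose_B_mul_P_mul_Φ, h2, h1]
  simp only [Matrix.neg_mul, Matrix.mul_neg, Matrix.mul_assoc]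
  abel

/-- Completion of squares: along the nominal dynamics the form `xᵀ P x` decreases by the stage
cost `xᵀ Q x + uᵀ R u`, up to the term that charges for the perturbation `c`. -/
theorem Admissible.quadForm_nominal_step (hS : S.Admissible Pr w) (x : Vec n) (c : Vec m) :
    quadForm S.P (S.Φ.toEuclideanLin x + S.B.toEuclideanLin c)
      = quadForm S.P x + quadForm S.inputWeight c - quadForm S.Q x
        - quadForm S.R (S.K.toEuclideanLin x + c) := by
  have hform : ∀ {k l r : ℕ} (X : Matrix (Fin k) (Fin l) ℝ) (M : Matrix (Fin k) (Fin k) ℝ)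
      (Y : Matrix (Fin k) (Fin r) ℝ) (u : Fin l → ℝ) (v : Fin r → ℝ),
      (X *ᵥ u) ⬝ᵥ (M * Y) *ᵥ v = u ⬝ᵥ (Xᵀ * M * Y) *ᵥ v := by
    intro k l r X M Y u v
    rw [Matrix.mul_assoc, ← Matrix.vecMul_transpose X u, ← Matrix.dotProduct_mulVec,
      Matrix.mulVec_mulVec]
  have hB : S.Bᵀ * S.P * S.B = S.inputWeight - S.R := by simp [inputWeight]
  have hK : (S.K *ᵥ x.ofLp) ⬝ᵥ S.R *ᵥ c.ofLp = x.ofLp ⬝ᵥ (S.Kᵀ * S.R) *ᵥ c.ofLp := by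
    simpa using hform S.K S.R 1 x.ofLp c.ofLp
  simp only [quadForm, WithLp.ofLp_add, Matrix.toLpLin_apply, Matrix.mulVec_add,
    add_dotProduct, dotProduct_add, hform, hS.transpose_Φ_mul_P_mul_Φ,
    hS.transpose_Φ_mul_P_mul_B, hS.transpose_B_mul_P_mul_Φ, hB, hK, Matrix.sub_mulVec,
    Matrix.neg_mulVec, dotProduct_sub, dotProduct_neg, Matrix.mulVec_mulVec]
  ring

end Data

namespace Data

variable {n m q nc N : ℕ} (S : Data n m q nc N)

/-! ### Linearity of the predictions -/

theorem perturbation_zero (i : ℕ) : perturbation (0 : Fin N → Vec m) i = 0 := by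
  simp [perturbation]

theorem perturbation_add (c c' : Fin N → Vec m) (i : ℕ) :
    perturbation (c + c') i = perturbation c i + perturbation c' i := by
  unfold perturbation
  split_ifs <;> simp

theorem perturbation_smul (t : ℝ) (c : Fin N → Vec m) (i : ℕ) :
    perturbation (t • c) i = t • perturbation c i := by
  unfold perturbation
  split_ifs <;> simp

theorem perturbation_of_le (c : Fin N → Vec m) {i : ℕ} (hi : N ≤ i) : perturbation c i = 0 :=
  dif_neg hi.not_gt

theorem norm_perturbation_le (c : Fin N → Vec m) (i : ℕ) : ‖perturbation c i‖ ≤ ‖c‖ := by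
  unfold perturbation
  split_ifs
  · exact norm_le_pi_norm c _
  · simp

theorem feedback_add (w w' : ℕ → Vec q) (i : ℕ) :
    S.feedback (w + w') i = S.feedback w i + S.feedback w' i := by
  simp [feedback, Finset.sum_add_distrib]

theorem feedback_smul (t : ℝ) (w : ℕ → Vec q) (i : ℕ) :
    S.feedback (t • w) i = t • S.feedback w i := by
  simp [feedback, Finset.smul_sum]

theorem feedback_zero (w : ℕ → Vec q) : S.feedback w 0 = 0 := by
  simp [feedback]

theorem predState_add (x x' : Vec n) (c c' : Fin N → Vec m) (w w' : ℕ → Vec q) (i : ℕ) :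
    S.predState (x + x') (c + c') (w + w') i = S.predState x c w i + S.predState x' c' w' i := by
  induction i with
  | zero => rfl
  | succ i ih =>
    simp only [predState, ih, perturbation_add, feedback_add, map_add, Pi.add_apply]
    abel

theorem predState_smul (t : ℝ) (x : Vec n) (c : Fin N → Vec m) (w : ℕ → Vec q) (i : ℕ) :
    S.predState (t • x) (t • c) (t • w) i = t • S.predState x c w i := by
  induction i with
  | zero => rfl
  | succ i ih =>
    simp only [predState, ih, perturbation_smul, feedback_smul, map_smul, map_add, Pi.smul_apply,
      smul_add]

theorem pred_add (x x' : Vec n) (c c' : Fin N → Vec m) (w w' : ℕ → Vec q) (i : ℕ) :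
    S.pred (x + x') (c + c') (w + w') i = S.pred x c w i + S.pred x' c' w' i := by
  simp only [pred, predInput, predState_add, perturbation_add, feedback_add, map_add,
    Prod.mk_add_mk, Prod.mk.injEq, true_and]
  abel

theorem pred_smul (t : ℝ) (x : Vec n) (c : Fin N → Vec m) (w : ℕ → Vec q) (i : ℕ) :
    S.pred (t • x) (t • c) (t • w) i = t • S.pred x c w i := by
  simp only [pred, predInput, predState_smul, perturbation_smul, feedback_smul, map_smul,
    Prod.smul_mk, smul_add]

theorem nominal_add_uncertain (x : Vec n) (c : Fin N → Vec m) (w : ℕ → Vec q) (i : ℕ) :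
    S.nominal x c i + S.uncertain w i = S.pred x c w i := by
  simpa [nominal, uncertain] using (S.pred_add x 0 c 0 0 w i).symm

/-- The nominal prediction as a continuous linear function of the state and the perturbations. -/
noncomputable def nominalCLM (i : ℕ) : Vec n × (Fin N → Vec m) →L[ℝ] Vec n × Vec m :=
  LinearMap.toContinuousLinearMap
    { toFun := fun p => S.nominal p.1 p.2 i
      map_add' := fun p p' => by simpa [nominal] using S.pred_add p.1 p'.1 p.2 p'.2 0 0 i
      map_smul' := fun t p => by simpa [nominal] using S.pred_smul t p.1 p.2 0 i }

theorem nominal_zero (i : ℕ) : S.nominal 0 0 i = 0 :=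
  (S.nominalCLM i).map_zero

theorem uncertain_zero (i : ℕ) : S.uncertain 0 i = 0 := S.nominal_zero i

/-! ### The shifted predictions -/

/-- The disturbance sequence `v, w 0, w 1, …`. -/
def delay (v : Vec q) (w : ℕ → Vec q) : ℕ → Vec q
  | 0 => v
  | j + 1 => w j

/-- The state that follows `x` under the perturbations `c` and the disturbance `v`. -/
noncomputable def successor (x : Vec n) (c : Fin N → Vec m) (v : Vec q) : Vec n :=
  S.Φ.toEuclideanLin x + S.B.toEuclideanLin (perturbation c 0) + S.D.toEuclideanLin v

/-- The candidate solution at the successor state: the tail of `c`, corrected by the feedback of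
the disturbance `v` that has been realized in the meantime. -/
noncomputable def shift (c : Fin N → Vec m) (v : Vec q) : Fin N → Vec m :=
  fun i => perturbation c (i + 1) + (S.L (i + 1)).toEuclideanLin v

theorem feedback_delay (v : Vec q) (w : ℕ → Vec q) (i : ℕ) :
    S.feedback (delay v w) (i + 1)
      = S.feedback w i + if i < N then (S.L (i + 1)).toEuclideanLin v else 0 := by
  unfold feedback
  have hdelay : ∀ k ≤ i, ∑ j ∈ Finset.Icc 1 k, (S.L j).toEuclideanLin (delay v w (i + 1 - j))
      = ∑ j ∈ Finset.Icc 1 k, (S.L j).toEuclideanLin (w (i - j)) := by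
    intro k hk
    refine Finset.sum_congr rfl fun j hj => ?_
    rw [Nat.sub_add_comm ((Finset.mem_Icc.1 hj).2.trans hk)]
    rfl
  split_ifs with h
  · rw [min_eq_left h, min_eq_left h.le, Finset.sum_Icc_succ_top (by omega), hdelay i le_rfl,
      Nat.sub_self]
    rfl
  · rw [min_eq_right (by omega), min_eq_right (by omega), hdelay N (by omega), add_zero]

theorem perturbation_shift (c : Fin N → Vec m) (v : Vec q) (i : ℕ) :
    perturbation (S.shift c v) i
      = perturbation c (i + 1) + if i < N then (S.L (i + 1)).toEuclideanLin v else 0 := by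
  by_cases h : i < N
  · simp [perturbation, shift, h]
  · rw [perturbation_of_le _ (by omega), perturbation_of_le _ (by omega), if_neg h, add_zero]

theorem Φ_apply (x : Vec n) :
    S.Φ.toEuclideanLin x
      = S.A.toEuclideanLin x + S.B.toEuclideanLin (S.K.toEuclideanLin x) := by
  simp [Φ, Matrix.toLpLin_apply, Matrix.mulVec_mulVec]

theorem predState_delay (x : Vec n) (c : Fin N → Vec m) (v : Vec q) (w : ℕ → Vec q) (i : ℕ) :
    S.predState x c (delay v w) (i + 1) = S.predState (S.successor x c v) (S.shift c v) w i := by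
  induction i with
  | zero =>
    simp only [predState, successor, feedback_zero, Φ_apply, map_add, delay, add_zero]
    abel
  | succ i ih =>
    rw [predState, ih, feedback_delay, predState, perturbation_shift]
    congr 3
    abel

/-- The predictions from the successor state, with the shifted perturbations, are the predictions
from the current state whose first disturbance is the realized one. -/
theorem pred_delay (x : Vec n) (c : Fin N → Vec m) (v : Vec q) (w : ℕ → Vec q) (i : ℕ) :
    S.pred x c (delay v w) (i + 1) = S.pred (S.successor x c v) (S.shift c v) w i := by
  simp only [pred, predInput, predState_delay, feedback_delay, perturbation_shift,
    Prod.mk.injEq, true_and]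
  abel

theorem uncertain_delay_zero (w : ℕ → Vec q) (i : ℕ) :
    S.uncertain (delay 0 w) (i + 1) = S.uncertain w i := by
  have h1 : S.successor 0 0 0 = 0 := by simp [successor, perturbation_zero]
  have h2 : S.shift 0 0 = 0 := by
    ext1 i
    simp [shift, perturbation_zero]
  rw [uncertain, pred_delay, h1, h2, uncertain]

theorem delay_mem {W : Set (Vec q)} {v : Vec q} {w : ℕ → Vec q} (hv : v ∈ W)
    (hw : ∀ j, w j ∈ W) : ∀ j, delay v w j ∈ W
  | 0 => hv
  | j + 1 => hw j

variable {S}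

theorem tighten_antitone (h0 : 0 ∈ S.W) (C : Set (Vec n × Vec m)) : Antitone (S.tighten C) := by
  refine antitone_nat_of_succ_le fun i z hz w hw => ?_
  rw [← uncertain_delay_zero]
  exact hz _ (delay_mem h0 hw)

theorem ConstraintAt.shift {x : Vec n} {c : Fin N → Vec m} {i : ℕ}
    (h : S.ConstraintAt x c (i + 1)) {v : Vec q} (hv : v ∈ S.W) :
    S.ConstraintAt (S.successor x c v) (S.shift c v) i := by
  have aux : ∀ C, S.nominal x c (i + 1) ∈ S.tighten C (i + 1) →
      S.nominal (S.successor x c v) (S.shift c v) i ∈ S.tighten C i := by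
    intro C hC w hw
    rw [nominal_add_uncertain, ← pred_delay, ← nominal_add_uncertain]
    exact hC _ (delay_mem hv hw)
  exact ⟨aux _ h.1, aux _ h.2⟩

variable {Ω : Type*} [MeasurableSpace Ω] {Pr : Measure Ω} {w : ℕ → Ω → Vec q}

theorem Admissible.constraintAt (hS : S.Admissible Pr w) {x : Vec n} {c : Fin N → Vec m}
    (h : S.Feasible x c) (i : ℕ) : S.ConstraintAt x c i :=
  (lt_or_ge i N).elim (fun hi => h i (by omega)) (hS.N₂_spec x c h i)

theorem Admissible.feasible_shift (hS : S.Admissible Pr w) {x : Vec n} {c : Fin N → Vec m}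
    (h : S.Feasible x c) {v : Vec q} (hv : v ∈ S.W) :
    S.Feasible (S.successor x c v) (S.shift c v) :=
  fun i _ => (hS.constraintAt h (i + 1)).shift hv

/-! ### The graph of the feasible perturbations -/

variable (S) in
/-- The pairs of a state and a feasible perturbation sequence. -/
def feasibleGraph : Set (Vec n × (Fin N → Vec m)) := {p | S.Feasible p.1 p.2}

theorem feasibleGraph_eq : S.feasibleGraph = ⋂ i : Fin (N + S.N₂),
    S.nominalCLM i ⁻¹' (S.tighten S.probSet i ∩ S.tighten S.Z i) := by
  ext p
  simp only [feasibleGraph, Feasible, Set.mem_iInter, Fin.forall_iff]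
  rfl

theorem tighten_eq_iInter (C : Set (Vec n × Vec m)) (i : ℕ) : S.tighten C i =
    ⋂ (w : ℕ → Vec q) (_ : ∀ j, w j ∈ S.W), (fun z => z + S.uncertain w i) ⁻¹' C := by
  ext z
  simp [tighten]

theorem isClosed_tighten {C : Set (Vec n × Vec m)} (hC : IsClosed C) (i : ℕ) :
    IsClosed (S.tighten C i) := by
  rw [tighten_eq_iInter]
  exact isClosed_iInter fun w => isClosed_iInter fun _ => hC.preimage (by fun_prop)

theorem convex_tighten {C : Set (Vec n × Vec m)} (hC : Convex ℝ C) (i : ℕ) :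
    Convex ℝ (S.tighten C i) := by
  rw [tighten_eq_iInter]
  exact convex_iInter fun w => convex_iInter fun _ => hC.translate_preimage_left _

/-- The tightened version of a half-space is the preimage of a lower set of `ℝ`, whether or not
the worst case is finite. -/
theorem isLocallyConic_tighten {C : Set (Vec n × Vec m)} (hC : IsPolyhedral C) (i : ℕ) :
    IsLocallyConic (S.tighten C i) := by
  obtain ⟨r, a, b, rfl⟩ := hC
  have h : S.tighten {z | ∀ l, a l z ≤ b l} i = ⋂ l, LinearMap.toContinuousLinearMap (a l) ⁻¹'
      {t | ∀ w : ℕ → Vec q, (∀ j, w j ∈ S.W) → t + a l (S.uncertain w i) ≤ b l} := by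
    ext z
    simp only [tighten, Set.mem_ofPred_eq, map_add, Set.mem_iInter, Set.mem_preimage,
      LinearMap.coe_toContinuousLinearMap']
    exact ⟨fun h l w hw => h w hw l, fun h w hw l => h l w hw⟩
  rw [h]
  refine .iInter fun l => IsLocallyConic.preimage (isLocallyConic_of_isLowerSet ?_) _
  intro s t hts hs w hw
  linarith [hs w hw]

end Data

theorem IsPolyhedral.convex {E : Type*} [AddCommGroup E] [Module ℝ E] {C : Set E}
    (hC : IsPolyhedral C) : Convex ℝ C := by
  obtain ⟨r, a, b, rfl⟩ := hC
  rw [Set.ofPred_forall]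
  exact convex_iInter fun l => convex_halfSpace_le (a l).isLinear (b l)

theorem IsPolyhedral.isClosed {n m : ℕ} {C : Set (Vec n × Vec m)} (hC : IsPolyhedral C) :
    IsClosed C := by
  obtain ⟨r, a, b, rfl⟩ := hC
  rw [Set.ofPred_forall]
  exact isClosed_iInter fun l =>
    isClosed_le (a l).continuous_of_finiteDimensional continuous_const

namespace Data

variable {n m q nc N : ℕ} {S : Data n m q nc N}
variable {Ω : Type*} [MeasurableSpace Ω] {Pr : Measure Ω} {w : ℕ → Ω → Vec q}

theorem isPolyhedral_probSet : IsPolyhedral S.probSet := by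
  refine ⟨nc, fun j => (innerₛₗ ℝ (S.f j)) ∘ₗ S.A.toEuclideanLin ∘ₗ LinearMap.fst ℝ _ _
    + ((innerₛₗ ℝ (S.f j)) ∘ₗ S.B.toEuclideanLin ∘ₗ LinearMap.snd ℝ _ _
      + (innerₛₗ ℝ (S.g j)) ∘ₗ LinearMap.snd ℝ _ _), fun j => S.h j - S.γ j, ?_⟩
  ext z
  simp [probSet, le_sub_iff_add_le]

theorem Admissible.zero_mem_W (hS : S.Admissible Pr w) : 0 ∈ S.W := interior_subset hS.W_zero

theorem Admissible.isLocallyConic_feasibleGraph (hS : S.Admissible Pr w) :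
    IsLocallyConic S.feasibleGraph := by
  rw [feasibleGraph_eq]
  exact .iInter fun i => ((isLocallyConic_tighten isPolyhedral_probSet i).inter
    (isLocallyConic_tighten hS.Z_polyhedral i)).preimage _

theorem Admissible.convex_feasibleGraph (hS : S.Admissible Pr w) : Convex ℝ S.feasibleGraph := by
  rw [feasibleGraph_eq]
  exact convex_iInter fun i => ((convex_tighten isPolyhedral_probSet.convex i).inter
    (convex_tighten hS.Z_polyhedral.convex i)).linear_preimage (S.nominalCLM i).toLinearMap

theorem Admissible.isClosed_feasibleGraph (hS : S.Admissible Pr w) :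
    IsClosed S.feasibleGraph := by
  rw [feasibleGraph_eq]
  exact isClosed_iInter fun i => ((isClosed_tighten isPolyhedral_probSet.isClosed i).inter
    (isClosed_tighten hS.Z_polyhedral.isClosed i)).preimage (S.nominalCLM i).continuous

/-- The hard constraint bounds `x` and, through `c i = u i - K (x i)`, the perturbations. -/
theorem Admissible.isCompact_feasibleGraph (hS : S.Admissible Pr w) :
    IsCompact S.feasibleGraph := by
  refine Metric.isCompact_of_isClosed_isBounded hS.isClosed_feasibleGraph ?_
  obtain ⟨M, hM⟩ := hS.Z_compact.isBounded.exists_norm_le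
  obtain ⟨C, hC, hK⟩ := exists_norm_toEuclideanLin_le S.K
  have hM0 : 0 ≤ M := (norm_nonneg _).trans (hM _ (interior_subset hS.Z_zero))
  refine isBounded_iff_forall_norm_le.2 ⟨M + C * M, ?_⟩
  rintro ⟨x, c⟩ hxc
  -- The zero disturbance is admissible, so the tightened sets lie in `Z`.
  have hZ : ∀ i < N, ‖S.nominal x c i‖ ≤ M := by
    intro i hi
    have h := (hxc i (by omega)).2 0 fun _ => hS.zero_mem_W
    rw [uncertain_zero, add_zero] at h
    exact hM _ h
  refine (Prod.norm_mk x c).trans_le (max_le ?_ ((pi_norm_le_iff_of_nonneg (by positivity)).2 ?_))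
  · have h := (norm_fst_le _).trans (hZ 0 hS.horizon_pos)
    exact (show ‖x‖ ≤ M from h).trans (by nlinarith)
  · intro i
    have hx : ‖S.predState x c 0 i‖ ≤ M := (norm_fst_le _).trans (hZ i i.2)
    have hu : ‖S.predInput x c 0 i‖ ≤ M := (norm_snd_le _).trans (hZ i i.2)
    have hc : c i = S.predInput x c 0 i - S.K.toEuclideanLin (S.predState x c 0 i) := by
      simp [predInput, feedback, perturbation]
    rw [hc]
    refine (norm_sub_le _ _).trans (add_le_add hu ((hK _).trans ?_))
    gcongr

/-! ### Feasibility of the origin -/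

theorem predState_zero_succ (x : Vec n) (c : Fin N → Vec m) (i : ℕ) :
    S.predState x c 0 (i + 1)
      = S.Φ.toEuclideanLin (S.predState x c 0 i) + S.B.toEuclideanLin (perturbation c i) := by
  have h : S.feedback 0 i = 0 := by simp [feedback]
  simp only [predState, h, Φ_apply, map_add, Pi.zero_apply, map_zero]
  abel

/-- Beyond the horizon `xᵀ P x` decreases along the nominal predictions by at least a multiple of
`‖x‖ ^ 2`, so the increments, and with them the predictions, tend to zero. -/
theorem Admissible.tendsto_nominal (hS : S.Admissible Pr w) (x : Vec n) (c : Fin N → Vec m) :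
    Tendsto (S.nominal x c) atTop (𝓝 0) := by
  obtain ⟨a, ha, hQ⟩ := exists_mul_sq_le_quadForm hS.Q_posDef
  have ha' : (0 : ℝ) < a := ha
  set y : ℕ → Vec n := fun k => S.predState x c 0 (k + N) with hy
  have hstep : ∀ k, a * ‖y k‖ ^ 2 ≤ quadForm S.P (y k) - quadForm S.P (y (k + 1)) := by
    intro k
    have h : y (k + 1) = S.Φ.toEuclideanLin (y k) + S.B.toEuclideanLin 0 := by
      simp only [hy]
      rw [add_right_comm, predState_zero_succ, perturbation_of_le _ (by omega)]
    rw [h, hS.quadForm_nominal_step, quadForm_zero]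
    linarith [hQ (y k), quadForm_nonneg hS.R_posDef (S.K.toEuclideanLin (y k) + 0)]
  have hanti : Antitone fun k => quadForm S.P (y k) :=
    antitone_nat_of_succ_le fun k => by
      have : 0 ≤ a * ‖y k‖ ^ 2 := by positivity
      linarith [hstep k]
  have hlim := tendsto_atTop_ciInf hanti
    ⟨0, Set.forall_mem_range.2 fun k => quadForm_nonneg hS.P_posDef _⟩
  have hdiff : Tendsto (fun k => (quadForm S.P (y k) - quadForm S.P (y (k + 1))) / a)
      atTop (𝓝 0) := by
    simpa using (hlim.sub (hlim.comp (tendsto_add_atTop_nat 1))).div_const (a : ℝ)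
  have hsq : Tendsto (fun k => ‖y k‖ ^ 2) atTop (𝓝 0) :=
    squeeze_zero (fun _ => by positivity)
      (fun k => (le_div_iff₀ ha').2 (by linarith [hstep k])) hdiff
  have hy0 : Tendsto y atTop (𝓝 0) := by
    rw [tendsto_zero_iff_norm_tendsto_zero]
    simpa [Real.sqrt_sq] using hsq.sqrt
  rw [← tendsto_add_atTop_iff_nat N]
  have hnom : (fun k => S.nominal x c (k + N)) = fun k => (y k, S.K.toEuclideanLin (y k)) := by
    ext1 k
    simp [nominal, pred, predInput, feedback, perturbation_of_le, hy]
  have hK : Tendsto (fun k => S.K.toEuclideanLin (y k)) atTop (𝓝 0) := by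
    have := (S.K.toEuclideanLin.continuous_of_finiteDimensional.tendsto 0).comp hy0
    rwa [map_zero] at this
  rw [hnom]
  exact hy0.prodMk_nhds hK

/-- If the online problem is feasible at some state then `c = 0` is feasible at the origin: the
nominal predictions tend to zero inside tightened sets that are closed and shrink with time. -/
theorem Admissible.feasible_zero (hS : S.Admissible Pr w) {x : Vec n} {c : Fin N → Vec m}
    (h : S.Feasible x c) : S.Feasible 0 0 := by
  have aux : ∀ C, IsClosed C → (∀ i, S.nominal x c i ∈ S.tighten C i) →
      ∀ i, S.nominal 0 0 i ∈ S.tighten C i := by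
    intro C hC hmem i
    rw [nominal_zero]
    refine (isClosed_tighten hC i).mem_of_tendsto (hS.tendsto_nominal x c) ?_
    filter_upwards [eventually_ge_atTop i] with k hk
    exact tighten_antitone hS.zero_mem_W C hk (hmem k)
  exact fun i _ =>
    ⟨aux _ isPolyhedral_probSet.isClosed (fun k => (hS.constraintAt h k).1) i,
      aux _ hS.Z_polyhedral.isClosed (fun k => (hS.constraintAt h k).2) i⟩

/-! ### The optimal value -/

theorem continuous_cost : Continuous fun p : Vec n × (Fin N → Vec m) => S.cost p.1 p.2 := by
  unfold cost
  exact ((continuous_quadForm _).comp continuous_fst).add (continuous_finsetSum _ fun i _ =>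
    (continuous_quadForm _).comp ((continuous_apply i).comp continuous_snd))

theorem Admissible.exists_isOptimal (hS : S.Admissible Pr w) {x : Vec n}
    (hx : x ∈ S.feasibleStates) : ∃ c, S.IsOptimal x c := by
  obtain ⟨c₀, hc₀⟩ := hx
  obtain ⟨⟨x', c⟩, ⟨hc, rfl⟩, hmin⟩ := (hS.isCompact_feasibleGraph.inter_right
    (isClosed_singleton.preimage continuous_fst : IsClosed (Prod.fst ⁻¹' {x}))).exists_isMinOn
    ⟨(x, c₀), hc₀, rfl⟩ continuous_cost.continuousOn
  exact ⟨c, hc, fun c' hc' => hmin (show (x', c') ∈ _ from ⟨hc', rfl⟩)⟩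

theorem cost_midpoint (x : Vec n) (c c' : Fin N → Vec m) :
    S.cost x ((1 / 2 : ℝ) • c + (1 / 2 : ℝ) • c')
      = S.cost x c / 2 + S.cost x c' / 2 - (∑ i, quadForm S.inputWeight (c i - c' i)) / 4 := by
  simp only [cost, Pi.add_apply, Pi.smul_apply, quadForm_midpoint, Finset.sum_sub_distrib,
    Finset.sum_add_distrib, Finset.sum_div]
  rw [add_div, add_div, Finset.sum_div, Finset.sum_div]
  ring

theorem Admissible.isOptimal_unique (hS : S.Admissible Pr w) {x : Vec n} {c c' : Fin N → Vec m}
    (hc : S.IsOptimal x c) (hc' : S.IsOptimal x c') : c = c' := by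
  have hmid : S.Feasible x ((1 / 2 : ℝ) • c + (1 / 2 : ℝ) • c') := by
    have h := hS.convex_feasibleGraph (show (x, c) ∈ S.feasibleGraph from hc.1)
      (show (x, c') ∈ S.feasibleGraph from hc'.1) (a := 1 / 2) (b := 1 / 2)
      (by norm_num) (by norm_num) (by norm_num)
    have hx : (1 / 2 : ℝ) • x + (1 / 2 : ℝ) • x = x := by module
    rwa [Prod.smul_mk, Prod.smul_mk, Prod.mk_add_mk, hx] at h
  have h1 := hc.2 _ hmid
  have h2 := hc.2 _ hc'.1
  have h3 := hc'.2 _ hc.1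
  rw [cost_midpoint] at h1
  have h4 : ∀ i ∈ Finset.univ, 0 ≤ quadForm S.inputWeight (c i - c' i) :=
    fun i _ => quadForm_nonneg hS.inputWeight_posDef _
  have h5 := (Finset.sum_eq_zero_iff_of_nonneg h4).1
    (le_antisymm (by linarith) (Finset.sum_nonneg h4))
  funext i
  by_contra hne
  exact (quadForm_pos hS.inputWeight_posDef (sub_ne_zero.2 hne)).ne' (h5 i (Finset.mem_univ i))

theorem Admissible.quadForm_le_cost (hS : S.Admissible Pr w) (x : Vec n) (c : Fin N → Vec m) :
    quadForm S.P x ≤ S.cost x c :=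
  le_add_of_nonneg_right (Finset.sum_nonneg fun _ _ => quadForm_nonneg hS.inputWeight_posDef _)

/-- The quadratic upper bound of the optimal value needs no interior of the set of feasible states
at the origin: a Lipschitz selection of feasible perturbations through `(0, 0)` suffices. -/
theorem Admissible.exists_cost_le (hS : S.Admissible Pr w) :
    ∃ C : ℝ≥0, 0 < C ∧ ∀ x c, S.IsOptimal x c → S.cost x c ≤ C * ‖x‖ ^ 2 := by
  by_cases hne : ∃ x c, S.Feasible x c
  · obtain ⟨x₀, c₀, h₀⟩ := hne
    obtain ⟨C₁, hC₁, hsel⟩ := exists_lipschitz_selection hS.convex_feasibleGraph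
      hS.isCompact_feasibleGraph hS.isLocallyConic_feasibleGraph
      (show (0, 0) ∈ S.feasibleGraph from hS.feasible_zero h₀)
    obtain ⟨CP, hCP, hP⟩ := exists_quadForm_le S.P
    obtain ⟨CM, hCM, hM⟩ := exists_quadForm_le S.inputWeight
    -- The summand `1` only serves to make the constant positive.
    have hpos : 0 < CP + N * (CM * C₁ ^ 2) + 1 := by positivity
    refine ⟨⟨_, hpos.le⟩, hpos, fun x c hc => ?_⟩
    obtain ⟨c', hc', hle⟩ := hsel x c hc.1
    rw [sub_zero, sub_zero] at hle
    have hsum : ∑ i, quadForm S.inputWeight (c' i) ≤ ∑ _i : Fin N, CM * (C₁ * ‖x‖) ^ 2 := by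
      refine Finset.sum_le_sum fun i _ => (hM _).trans ?_
      have := (norm_le_pi_norm c' i).trans hle
      gcongr
    simp only [Finset.sum_const, Finset.card_univ, Fintype.card_fin, nsmul_eq_mul] at hsum
    refine (hc.2 c' hc').trans ?_
    change _ ≤ (CP + N * (CM * C₁ ^ 2) + 1) * ‖x‖ ^ 2
    calc S.cost x c' ≤ CP * ‖x‖ ^ 2 + N * (CM * (C₁ * ‖x‖) ^ 2) := add_le_add (hP x) hsum
      _ ≤ _ := by nlinarith [sq_nonneg ‖x‖]
  · exact ⟨1, one_pos, fun x c hc => (hne ⟨x, c, hc.1⟩).elim⟩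

theorem cost_eq_sum_range (x : Vec n) (c : Fin N → Vec m) :
    S.cost x c = quadForm S.P x
      + ∑ i ∈ Finset.range N, quadForm S.inputWeight (perturbation c i) := by
  rw [cost, ← Fin.sum_univ_eq_sum_range fun i => quadForm S.inputWeight (perturbation c i)]
  simp [perturbation]

/-- The shifted perturbations decrease the cost by `xᵀ Q x`, up to a multiple of the size of the
disturbance: without disturbance the cost terms telescope by the Riccati equation. -/
theorem Admissible.exists_cost_shift_le (hS : S.Admissible Pr w) :
    ∃ ℓ : ℝ≥0, 0 < ℓ ∧ ∀ x c v, S.Feasible x c → v ∈ S.W →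
      S.cost (S.successor x c v) (S.shift c v) ≤ S.cost x c - quadForm S.Q x + ℓ * ‖v‖ := by
  obtain ⟨r, hr⟩ := hS.isCompact_feasibleGraph.isBounded.exists_norm_le
  obtain ⟨rW, hrW⟩ := hS.W_bounded.exists_norm_le
  obtain ⟨CΦ, hCΦ, hΦ⟩ := exists_norm_toEuclideanLin_le S.Φ
  obtain ⟨CB, hCB, hB⟩ := exists_norm_toEuclideanLin_le S.B
  obtain ⟨ℓ₀, hℓ₀, hP⟩ := exists_quadForm_add_le S.P S.D (CΦ * r + CB * r) rW
  choose ℓ hℓ hM using fun i => exists_quadForm_add_le S.inputWeight (S.L (i + 1)) r rW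
  -- The summand `1` only serves to make the constant positive.
  have hpos : 0 < ℓ₀ + ∑ i ∈ Finset.range N, ℓ i + 1 := by
    have := Finset.sum_nonneg fun i (_ : i ∈ Finset.range N) => hℓ i
    positivity
  refine ⟨⟨_, hpos.le⟩, hpos, fun x c v hxc hv => ?_⟩
  have hx : ‖x‖ ≤ r := (norm_fst_le (x, c)).trans (hr _ hxc)
  have hc : ∀ i, ‖perturbation c i‖ ≤ r := fun i =>
    (norm_perturbation_le c i).trans ((norm_snd_le (x, c)).trans (hr _ hxc))
  have h1 : quadForm S.P (S.successor x c v)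
      ≤ quadForm S.P x + quadForm S.inputWeight (perturbation c 0) - quadForm S.Q x
        + ℓ₀ * ‖v‖ := by
    have hle := hP (S.Φ.toEuclideanLin x + S.B.toEuclideanLin (perturbation c 0)) v
      ((norm_add_le _ _).trans (add_le_add ((hΦ x).trans (by gcongr))
        ((hB _).trans (mul_le_mul_of_nonneg_left (hc 0) hCB)))) (hrW v hv)
    rw [hS.quadForm_nominal_step] at hle
    have hR := quadForm_nonneg hS.R_posDef (S.K.toEuclideanLin x + perturbation c 0)
    rw [successor]
    linarith
  have h2 : ∑ i ∈ Finset.range N, quadForm S.inputWeight (perturbation (S.shift c v) i)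
      ≤ ∑ i ∈ Finset.range N, (quadForm S.inputWeight (perturbation c (i + 1)) + ℓ i * ‖v‖) := by
    refine Finset.sum_le_sum fun i hi => ?_
    rw [perturbation_shift, if_pos (Finset.mem_range.1 hi)]
    exact hM i _ v (hc (i + 1)) (hrW v hv)
  rw [Finset.sum_add_distrib, ← Finset.sum_mul] at h2
  have h3 : ∑ i ∈ Finset.range N, quadForm S.inputWeight (perturbation c (i + 1))
      + quadForm S.inputWeight (perturbation c 0)
      = ∑ i ∈ Finset.range N, quadForm S.inputWeight (perturbation c i) := by
    rw [← Finset.sum_range_succ' fun i => quadForm S.inputWeight (perturbation c i),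
      Finset.sum_range_succ, perturbation_of_le c le_rfl, quadForm_zero, add_zero]
  rw [cost_eq_sum_range, cost_eq_sum_range]
  change _ ≤ _ + (ℓ₀ + ∑ i ∈ Finset.range N, ℓ i + 1) * ‖v‖
  have := norm_nonneg v
  linarith

end Data

end StripedMPC

open StripedMPC in
theorem mainTheorem4 {n m q nc N : ℕ} (S : StripedMPC.Data n m q nc N)
    {Ω : Type*} [MeasurableSpace Ω] (Pr : MeasureTheory.Measure Ω)
    [MeasureTheory.IsProbabilityMeasure Pr] (w : ℕ → Ω → StripedMPC.Vec q)
    (hS : S.Admissible Pr w) :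
    (∀ x ∈ S.feasibleStates, ∃! c, S.IsOptimal x c) ∧
    ∀ cstar : StripedMPC.Vec n → Fin N → StripedMPC.Vec m,
      (∀ x ∈ S.feasibleStates, S.IsOptimal x (cstar x)) →
        StripedMPC.IsISSLyapunov (S.closedLoop cstar) S.feasibleStates S.W
          (S.optimalValue cstar) ∧
        StripedMPC.IsISS (S.closedLoop cstar) S.feasibleStates S.W := by
  refine ⟨fun x hx => ?_, fun cstar hopt => ?_⟩
  · obtain ⟨c, hc⟩ := hS.exists_isOptimal hx
    exact ⟨c, hc, fun c' hc' => hS.isOptimal_unique hc' hc⟩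
  obtain ⟨a, ha, hP⟩ := exists_mul_sq_le_quadForm hS.P_posDef
  obtain ⟨b, hb, hQ⟩ := exists_mul_sq_le_quadForm hS.Q_posDef
  obtain ⟨C, hC, hup⟩ := hS.exists_cost_le
  obtain ⟨ℓ, hℓ, hshift⟩ := hS.exists_cost_shift_le
  have hfeas : ∀ x ∈ S.feasibleStates, ∀ v ∈ S.W,
      S.Feasible (S.closedLoop cstar x v) (S.shift (cstar x) v) :=
    fun x hx v hv => hS.feasible_shift (hopt x hx).1 hv
  have hmap : ∀ x ∈ S.feasibleStates, ∀ v ∈ S.W, S.closedLoop cstar x v ∈ S.feasibleStates :=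
    fun x hx v hv => ⟨_, hfeas x hx v hv⟩
  have hlow' : ∀ x ∈ S.feasibleStates, a * ‖x‖ ^ 2 ≤ S.optimalValue cstar x :=
    fun x _ => (hP x).trans (hS.quadForm_le_cost x _)
  have hup' : ∀ x ∈ S.feasibleStates, S.optimalValue cstar x ≤ C * ‖x‖ ^ 2 :=
    fun x hx => hup x _ (hopt x hx)
  have hdec : ∀ x ∈ S.feasibleStates, ∀ v ∈ S.W, S.optimalValue cstar (S.closedLoop cstar x v)
      ≤ S.optimalValue cstar x - b * ‖x‖ ^ 2 + ℓ * ‖v‖ := by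
    intro x hx v hv
    have h1 : S.optimalValue cstar (S.closedLoop cstar x v)
        ≤ S.cost (S.closedLoop cstar x v) (S.shift (cstar x) v) :=
      (hopt _ (hmap x hx v hv)).2 _ (hfeas x hx v hv)
    have h2 : S.cost (S.closedLoop cstar x v) (S.shift (cstar x) v)
        ≤ S.optimalValue cstar x - quadForm S.Q x + ℓ * ‖v‖ :=
      hshift x (cstar x) v (hopt x hx).1 hv
    linarith [hQ x]
  refine ⟨⟨hmap, ?_, fun s => a * s ^ 2, fun s => C * s ^ 2, fun s => b * s ^ 2, fun s => ℓ * s,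
    isClassKInf_const_mul_pow ha two_ne_zero, isClassKInf_const_mul_pow hC two_ne_zero,
    isClassKInf_const_mul_pow hb two_ne_zero, isClassK_const_mul hℓ, fun x hx => ?_,
    fun x hx v hv => ?_⟩, isISS_of_quadratic ha hC hb hℓ hmap hlow' hup' hdec⟩
  · exact continuousOn_optimalValue hS.convex_feasibleGraph hS.isCompact_feasibleGraph
      hS.isLocallyConic_feasibleGraph Data.continuous_cost (fun x hx => (hopt x hx).1)
      fun x hx => (hopt x hx).2
  · exact ⟨by simpa using hlow' x hx, by simpa using hup' x hx⟩
  · have := hdec x hx v hv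
    push_cast
    linarith
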